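/- Let $N\ge 1$ and let $G:\mathbb{R}^N\to\mathbb{R}$ satisfy: (G1) $G\ge 0$ and $\operatorname{supp}G=\mathbb{R}^N$; (G2) $G\in W^{1,1}(\mathbb{R}^N)\cap L^\infty(\mathbb{R}^N)\cap C^2(\mathbb{R}^N)$ and $\|G\|_{L^1}=1$; (G3) $G(x)=g(|x|)$ for a function $g$ on $[0,\infty)$ with $g'(r)<0$ for all $r>0$; (G4) $g''(0)<0$ (one-sided derivatives at $0$) and $\lim_{r\to\infty}g(r)=0$. Let $m>1$ and $\varepsilon>0$. Let $\mathcal{P}(\mathbb{R}^N)$ be the set of non-negative $\rho\in L^1(\mathbb{R}^N)$ with $\int_{\mathbb{R}^N}\rho(x)\,dx=1$, and for $\rho\in L^m(\mathbb{R}^N)\cap\mathcal{P}(\mathbb{R}^N)$ put $$E[\rho]=\int_{\mathbb{R}^N}\frac{\varepsilon}{m}\rho^m(x)\,dx-\frac12\int_{\mathbb{R}^N}\int_{\mathbb{R}^N}G(x-y)\rho(y)\rho(x)\,dy\,dx .$$ If $\rho\in L^m(\mathbb{R}^N)\cap\mathcal{P}(\mathbb{R}^N)$ is a global minimizer of $E$,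 that is, $E[\rho]\le E[\sigma]$ for all $\sigma\in L^m(\mathbb{R}^N)\cap\mathcal{P}(\mathbb{R}^N)$, then $\rho$ has compact support, where the support of $\rho$ is the complement of the largest open set on which $\rho=0$ almost everywhere. -/

import Mathlib

open MeasureTheory Set Filter Topology
open scoped ContDiff

noncomputable section

namespace Aggregation

/-- The space `ℝ^N` with its Euclidean norm. -/
abbrev Space (N : ℕ) : Type := EuclideanSpace ℝ (Fin N)

/-- `V` is the weak gradient of `f` on `ℝ^N` (integration by parts against all test functions
`φ ∈ C_c^∞(ℝ^N)` in all directions `v`). -/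
def IsWeakGradient {N : ℕ} (f : Space N → ℝ) (V : Space N → Space N) : Prop :=
  ∀ φ : Space N → ℝ, ContDiff ℝ ∞ φ → HasCompactSupport φ → ∀ v : Space N,
    ∫ x, f x * fderiv ℝ φ x v = - ∫ x, inner ℝ (V x) v * φ x

/-- Membership in the Sobolev space `W^{1,1}(ℝ^N)`. -/
def MemW11 {N : ℕ} (f : Space N → ℝ) : Prop :=
  Integrable f ∧ ∃ V : Space N → Space N, Integrable V ∧ IsWeakGradient f V

/-- The standing assumptions on the interaction potential `G : ℝ^N → ℝ` with radial
profile `g`. Only the values of `g` on `[0, ∞)` matter; derivatives of `g` at `0` are one-sided. -/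
structure IsPotential {N : ℕ} (G : Space N → ℝ) (g : ℝ → ℝ) : Prop where
  nonneg : ∀ x, 0 ≤ G x
  supp_eq : tsupport G = univ
  memW11 : MemW11 G
  bounded : MemLp G ⊤ volume
  contDiff : ContDiff ℝ 2 G
  norm_one : ∫ x, |G x| = 1
  radial : ∀ x, G x = g ‖x‖
  deriv_neg : ∀ r : ℝ, 0 < r → deriv g r < 0
  second_deriv_neg : iteratedDerivWithin 2 g (Ici 0) 0 < 0
  tendsto_zero : Tendsto g atTop (𝓝 0)

/-- `𝒫(ℝ^N)`: non-negative integrable functions of mass one. -/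
def probDensities (N : ℕ) : Set (Space N → ℝ) :=
  {f | Integrable f ∧ (∀ᵐ x, 0 ≤ f x) ∧ ∫ x, f x = 1}

/-- `L^m(ℝ^N) ∩ 𝒫(ℝ^N)`. -/
def admissible (N : ℕ) (m : ℝ) : Set (Space N → ℝ) :=
  {f | MemLp f (ENNReal.ofReal m) volume} ∩ probDensities N

/-- The energy
`E[ρ] = ∫ (ε/m) ρ(x)^m dx - (1/2) ∫∫ G(x - y) ρ(y) ρ(x) dy dx`. -/
def energy {N : ℕ} (G : Space N → ℝ) (ε m : ℝ) (ρ : Space N → ℝ) : ℝ :=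
  (∫ x, ε / m * ρ x ^ m) - 1 / 2 * ∫ x, ∫ y, G (x - y) * ρ y * ρ x

/-- `ρ` is a global minimizer of the energy in `L^m(ℝ^N) ∩ 𝒫(ℝ^N)`. -/
def IsGlobalMinimizer {N : ℕ} (G : Space N → ℝ) (ε m : ℝ) (ρ : Space N → ℝ) : Prop :=
  ρ ∈ admissible N m ∧ ∀ σ ∈ admissible N m, energy G ε m ρ ≤ energy G ε m σ

/-- The support of (the almost-everywhere class of) `f`: the points all of whose neighbourhoods
meet `{f ≠ 0}` in positive measure, that is, the complement of the largest open set on which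
`f = 0` almost everywhere. -/
def essSupport {N : ℕ} (f : Space N → ℝ) : Set (Space N) :=
  {x | ∀ U ∈ 𝓝 x, 0 < volume ({y | f y ≠ 0} ∩ U)}

end Aggregation

end

/-! Testing minimality along segments in the convex set of admissible densities gives the
Euler–Lagrange conditions: with `C` the integral of the first variation `ε ρ^(m-1) - G * ρ` against
`ρ`, this function is at least `C` a.e. and equals `C` where `ρ ≠ 0`. The sign of `C` then decides.

If `C < 0`, then `G * ρ ≥ -C` a.e. where `ρ ≠ 0`; since `G * ρ` vanishes at infinity, `ρ` vanishes
off a compact set. If `C > 0`, then `ρ` has a positive lower bound a.e., contradicting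
integrability.

If `C = 0`, positivity of `G * ρ` gives `ε ρ^(m-1) = G * ρ` a.e., which is impossible. For `m < 2`
the energy would be positive, although spreading mass makes it arbitrarily small
(`not_eulerLagrange_of_lt_two`). For `m = 2`, `ρ = G * ρ` contradicts the maximum principle
(`not_eulerLagrange_two`). For `m > 2`, far away `ρ^(m-1)` is too small compared with `ρ` to balance
`G * ρ` (`not_eulerLagrange_of_two_lt`). -/

namespace Aggregation

variable {N : ℕ}

/-- The potential `G * f` generated by the density `f`. -/
noncomputable def pot (G f : Space N → ℝ) (x : Space N) : ℝ := ∫ y, G (x - y) * f y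

/-! ### The potential `G * f` and the interaction form -/

section Potential

variable {G f h : Space N → ℝ} {M : ℝ}

theorem integrable_pot_kernel (hc : Continuous G) (hM : ∀ x, |G x| ≤ M) (hf : Integrable f)
    (x : Space N) : Integrable fun y => G (x - y) * f y :=
  hf.bdd_mul (c := M) (by fun_prop) (Eventually.of_forall fun y => hM _)

theorem continuous_pot (hc : Continuous G) (hM : ∀ x, |G x| ≤ M) (hf : Integrable f) :
    Continuous (pot G f) := by
  refine continuous_of_dominated (bound := fun y => M * |f y|) ?_ ?_ (hf.abs.const_mul M) ?_
  · exact fun x => (integrable_pot_kernel hc hM hf x).aestronglyMeasurable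
  · refine fun x => Eventually.of_forall fun y => ?_
    rw [Real.norm_eq_abs, abs_mul]
    exact mul_le_mul_of_nonneg_right (hM _) (abs_nonneg _)
  · exact Eventually.of_forall fun y => by fun_prop

theorem abs_pot_le (hM : ∀ x, |G x| ≤ M) (hf : Integrable f) (x : Space N) :
    |pot G f x| ≤ M * ∫ y, |f y| := by
  rw [← integral_const_mul, ← Real.norm_eq_abs]
  refine norm_integral_le_of_norm_le (hf.abs.const_mul M) (Eventually.of_forall fun y => ?_)
  rw [Real.norm_eq_abs, abs_mul]
  exact mul_le_mul_of_nonneg_right (hM _) (abs_nonneg _)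

theorem integrable_pot_mul (hc : Continuous G) (hM : ∀ x, |G x| ≤ M) (hf : Integrable f)
    (hh : Integrable h) : Integrable fun x => pot G f x * h x :=
  hh.bdd_mul (c := M * ∫ y, |f y|) (continuous_pot hc hM hf).aestronglyMeasurable
    (Eventually.of_forall fun x => abs_pot_le hM hf x)

theorem tendsto_pot (hc : Continuous G) (hM : ∀ x, |G x| ≤ M)
    (h0 : Tendsto G (cocompact _) (𝓝 0)) (hf : Integrable f) :
    Tendsto (pot G f) (cocompact _) (𝓝 0) := by
  have key : Tendsto (fun x => ∫ y, G (x - y) * f y) (cocompact (Space N))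
      (𝓝 (∫ _ : Space N, (0 : ℝ))) := by
    rw [← Metric.cobounded_eq_cocompact] at h0 ⊢
    -- Dominated convergence along a filter requires it to be countably generated.
    have : (Bornology.cobounded (Space N)).IsCountablyGenerated := by
      rw [← comap_norm_atTop]
      infer_instance
    refine tendsto_integral_filter_of_dominated_convergence (fun y => M * |f y|) ?_ ?_
      (hf.abs.const_mul M) ?_
    · exact Eventually.of_forall fun x => (integrable_pot_kernel hc hM hf x).aestronglyMeasurable
    · refine Eventually.of_forall fun x => Eventually.of_forall fun y => ?_
      rw [Real.norm_eq_abs, abs_mul]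
      exact mul_le_mul_of_nonneg_right (hM _) (abs_nonneg _)
    · refine Eventually.of_forall fun y => ?_
      have hs : Tendsto (fun x : Space N => x - y) (Bornology.cobounded _)
          (Bornology.cobounded _) := by
        rw [Metric.cobounded_eq_cocompact]
        exact (Homeomorph.subRight y).isClosedEmbedding.tendsto_cocompact
      simpa using (h0.comp hs).mul_const (f y)
  rwa [integral_zero] at key

theorem pot_add_smul (hc : Continuous G) (hM : ∀ x, |G x| ≤ M) (hf : Integrable f)
    (hh : Integrable h) (t : ℝ) (x : Space N) :
    pot G (fun y => f y + t * h y) x = pot G f x + t * pot G h x := by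
  unfold pot
  rw [← integral_const_mul, ← integral_add (integrable_pot_kernel hc hM hf x)
    ((integrable_pot_kernel hc hM hh x).const_mul t)]
  congr 1 with y
  ring

theorem integral_pot_mul_comm (hc : Continuous G) (hM : ∀ x, |G x| ≤ M)
    (heven : ∀ x, G (-x) = G x) (hf : Integrable f) (hh : Integrable h) :
    ∫ x, pot G f x * h x = ∫ x, pot G h x * f x := by
  have hint : Integrable (Function.uncurry fun x y => G (x - y) * f y * h x)
      (volume.prod volume) := by
    have h1 : Integrable (fun z : Space N × Space N => h z.1 * f z.2) (volume.prod volume) :=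
      hh.mul_prod hf
    have h2 : Integrable (fun z : Space N × Space N => G (z.1 - z.2) * (h z.1 * f z.2))
        (volume.prod volume) :=
      h1.bdd_mul (c := M) (by fun_prop) (Eventually.of_forall fun z => hM _)
    refine h2.congr (Eventually.of_forall fun z => ?_)
    simp only [Function.uncurry]
    ring
  have hs := integral_integral_swap hint
  simp only [pot, ← integral_mul_const]
  rw [hs]
  congr 1 with y
  congr 1 with x
  rw [← heven (x - y), neg_sub]
  ring

theorem integral_pot (hG : Integrable G) (hf : Integrable f) :
    ∫ x, pot G f x = (∫ x, G x) * ∫ x, f x := by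
  have hint : Integrable (Function.uncurry fun x y => G (x - y) * f y)
      (volume.prod volume) := by
    refine (hf.convolution_integrand (ContinuousLinearMap.mul ℝ ℝ) hG).congr
      (Eventually.of_forall fun z => ?_)
    simp [Function.uncurry, mul_comm]
  unfold pot
  rw [integral_integral_swap hint]
  simp only [integral_mul_const, integral_sub_right_eq_self]
  rw [integral_const_mul]

theorem energy_eq (G : Space N → ℝ) (ε m : ℝ) (f : Space N → ℝ) :
    energy G ε m f = ε / m * (∫ x, f x ^ m) - 1 / 2 * ∫ x, pot G f x * f x := by
  simp only [energy, pot, ← integral_mul_const, integral_const_mul]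

end Potential

/-- Convexity of the power, obtained from Young's inequality with exponents `m / (m - 1)` and `m`.
The tangent is taken at `a`, so with `a` the perturbed density the energy increment is bounded from
above. -/
theorem rpow_sub_rpow_le {a b m : ℝ} (ha : 0 ≤ a) (hb : 0 ≤ b) (hm : 1 < m) :
    a ^ m - b ^ m ≤ m * (a ^ (m - 1) * (a - b)) := by
  have hm0 : 0 < m := by linarith
  have hm1 : 0 < m - 1 := by linarith
  have hconj : (m / (m - 1)).HolderConjugate m := by
    rw [Real.holderConjugate_iff]
    refine ⟨by rw [lt_div_iff₀ hm1]; linarith, ?_⟩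
    field_simp
    ring
  have hy := Real.young_inequality_of_nonneg (Real.rpow_nonneg ha (m - 1)) hb hconj
  have e1 : (a ^ (m - 1)) ^ (m / (m - 1)) = a ^ m := by
    rw [← Real.rpow_mul ha]
    congr 1
    field_simp
  have e2 : a ^ (m - 1) * a = a ^ m := by
    rw [← Real.rpow_add_one' ha (by linarith)]
    congr 1
    ring
  rw [e1] at hy
  have : m * (a ^ (m - 1) * b) ≤ (m - 1) * a ^ m + b ^ m := by
    calc m * (a ^ (m - 1) * b) ≤ m * (a ^ m / (m / (m - 1)) + b ^ m / m) := by gcongr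
      _ = _ := by field_simp
  rw [mul_sub, e2, mul_sub]
  linarith

theorem rpow_sub_one_mul_self {a m : ℝ} (ha : 0 ≤ a) (hm : 1 < m) :
    a ^ (m - 1) * a = a ^ m := by
  rw [← Real.rpow_add_one' ha (by linarith)]
  congr 1
  ring

/-! ### Admissible densities and their convex combinations -/

section Admissible

variable {f h : Space N → ℝ} {m : ℝ}

theorem MemLp.integrable_abs_rpow (hm : 1 < m) (hf : MemLp f (ENNReal.ofReal m) volume) :
    Integrable fun x => |f x| ^ m := by
  have := hf.integrable_norm_rpow (by simp; linarith) (by simp)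
  rwa [ENNReal.toReal_ofReal (by linarith)] at this

theorem integrable_rpow (hm : 1 < m) (hf : f ∈ admissible N m) :
    Integrable fun x => f x ^ m := by
  refine (MemLp.integrable_abs_rpow hm hf.1).congr ?_
  filter_upwards [hf.2.2.1] with x hx
  rw [abs_of_nonneg hx]

theorem convexComb_mem_admissible (hf : f ∈ admissible N m)
    (hh : h ∈ admissible N m) {t : ℝ} (ht : t ∈ Icc (0 : ℝ) 1) :
    (fun x => f x + t * (h x - f x)) ∈ admissible N m := by
  refine ⟨hf.1.add ((hh.1.sub hf.1).const_mul t),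
    hf.2.1.add ((hh.2.1.sub hf.2.1).const_mul t), ?_, ?_⟩
  · filter_upwards [hf.2.2.1, hh.2.2.1] with x h1 h2
    nlinarith [mul_nonneg ht.1 h2, mul_nonneg (sub_nonneg.2 ht.2) h1]
  · change ∫ x, (f x + t * (h x - f x)) = 1
    have hd : Integrable fun x => h x - f x := hh.2.1.sub hf.2.1
    rw [integral_add hf.2.1 (hd.const_mul t), integral_const_mul,
      integral_sub hh.2.1 hf.2.1, hf.2.2.2, hh.2.2.2]
    ring

theorem indicator_mem_admissible (m : ℝ) {s : Set (Space N)} (hs : MeasurableSet s)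
    (h0 : volume s ≠ 0) (htop : volume s ≠ ⊤) :
    s.indicator (fun _ => (volume.real s)⁻¹) ∈ admissible N m := by
  refine ⟨memLp_indicator_const _ hs _ (Or.inr htop), ?_, ?_, ?_⟩
  · exact (integrable_indicator_iff hs).2 (integrableOn_const htop)
  · exact Eventually.of_forall fun x => indicator_nonneg (fun _ _ => by positivity) x
  · rw [integral_indicator_const _ hs, smul_eq_mul, mul_inv_cancel₀]
    exact (ENNReal.toReal_pos h0 htop).ne'

theorem integrable_rpow_sub_one_mul (hm : 1 < m) (hf : f ∈ admissible N m)
    (hh : h ∈ admissible N m) : Integrable fun x => f x ^ (m - 1) * h x := by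
  refine ((integrable_rpow hm hf).add (integrable_rpow hm hh)).mono' ?_ ?_
  · exact (hf.2.1.aestronglyMeasurable.aemeasurable.pow_const _).aestronglyMeasurable.mul
      hh.2.1.aestronglyMeasurable
  · filter_upwards [hf.2.2.1, hh.2.2.1] with x h1 h2
    rw [Real.norm_of_nonneg (by positivity)]
    have hm1 : 0 < m - 1 := by linarith
    rcases le_total (f x) (h x) with hl | hl
    · calc f x ^ (m - 1) * h x ≤ h x ^ (m - 1) * h x := by gcongr
        _ = h x ^ m := rpow_sub_one_mul_self h2 hm
        _ ≤ f x ^ m + h x ^ m := by have := Real.rpow_nonneg h1 m; linarith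
    · calc f x ^ (m - 1) * h x ≤ f x ^ (m - 1) * f x := by gcongr
        _ = f x ^ m := rpow_sub_one_mul_self h1 hm
        _ ≤ f x ^ m + h x ^ m := by have := Real.rpow_nonneg h2 m; linarith

/-- Dominated convergence: both the convex combination and `|h - f|` are at most `f + h`, so `(f +
h)^m` is a majorant. -/
theorem tendsto_integral_rpow_convexComb (hm : 1 < m) (hf : f ∈ admissible N m)
    (hh : h ∈ admissible N m) :
    Tendsto (fun t : ℝ => ∫ x, (f x + t * (h x - f x)) ^ (m - 1) * (h x - f x)) (𝓝[>] 0)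
      (𝓝 (∫ x, f x ^ (m - 1) * (h x - f x))) := by
  have hm1 : 0 < m - 1 := by linarith
  have hb : Integrable fun x => |(|f x| + |h x|)| ^ m :=
    MemLp.integrable_abs_rpow hm (hf.1.abs.add hh.1.abs)
  have hmem : ∀ᶠ t : ℝ in 𝓝[>] 0, t ∈ Icc (0 : ℝ) 1 :=
    mem_of_superset (Ioo_mem_nhdsGT one_pos) Ioo_subset_Icc_self
  refine tendsto_integral_filter_of_dominated_convergence _ ?_ ?_ hb ?_
  · filter_upwards with t
    exact ((hf.2.1.add ((hh.2.1.sub hf.2.1).const_mul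
      t)).aestronglyMeasurable.aemeasurable.pow_const _).aestronglyMeasurable.mul
      (hh.2.1.sub hf.2.1).aestronglyMeasurable
  · filter_upwards [hmem] with t ht
    filter_upwards [hf.2.2.1, hh.2.2.1] with x h1 h2
    have hp : 0 ≤ f x + t * (h x - f x) := by
      nlinarith [mul_nonneg ht.1 h2, mul_nonneg (sub_nonneg.2 ht.2) h1]
    have hl : f x + t * (h x - f x) ≤ f x + h x := by
      nlinarith [mul_nonneg ht.1 h1, mul_nonneg (sub_nonneg.2 ht.2) h2]
    rw [abs_of_nonneg h1, abs_of_nonneg h2, abs_of_nonneg (add_nonneg h1 h2), norm_mul,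
      Real.norm_of_nonneg (Real.rpow_nonneg hp _),
      ← rpow_sub_one_mul_self (add_nonneg h1 h2) hm]
    gcongr
    rw [Real.norm_eq_abs, abs_le]
    constructor <;> linarith
  · filter_upwards with x
    have hcont : Continuous fun t : ℝ => (f x + t * (h x - f x)) ^ (m - 1) * (h x - f x) :=
      ((by fun_prop : Continuous fun t : ℝ => f x + t * (h x - f x)).rpow_const
        fun _ => Or.inr hm1.le).mul continuous_const
    have := (hcont.tendsto 0).mono_left (nhdsWithin_le_nhds (s := Ioi (0 : ℝ)))
    simpa using this

end Admissible

/-! ### Positivity, decay and boundedness of the kernel -/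

namespace IsPotential

variable {G : Space N → ℝ} {g : ℝ → ℝ}

theorem continuous (hG : IsPotential G g) : Continuous G := hG.contDiff.continuous

theorem even (hG : IsPotential G g) (x : Space N) : G (-x) = G x := by
  rw [hG.radial, hG.radial, norm_neg]

theorem strictAntiOn (hG : IsPotential G g) : StrictAntiOn g (Ioi 0) := by
  refine strictAntiOn_of_deriv_neg (convex_Ioi 0) (fun r hr => ?_) fun r hr => ?_
  · exact (differentiableAt_of_deriv_ne_zero
      (hG.deriv_neg r hr).ne).continuousAt.continuousWithinAt
  · rw [interior_Ioi] at hr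
    exact hG.deriv_neg r hr

theorem profile_pos (hG : IsPotential G g) {r : ℝ} (hr : 0 < r) : 0 < g r := by
  have hr1 : (0 : ℝ) < r + 1 := by linarith
  have h1 : g (r + 1) < g r := hG.strictAntiOn hr hr1 (by linarith)
  have h2 : 0 ≤ g (r + 1) := by
    refine le_of_tendsto hG.tendsto_zero ?_
    filter_upwards [eventually_ge_atTop (r + 1)] with s hs
    exact hG.strictAntiOn.antitoneOn hr1 (hr1.trans_le hs) hs
  linarith

/-- The sign of `g'` says nothing about `g` at `0`, so the value at the origin is reached by
continuity of `G` along a ray. -/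
theorem pos [Nontrivial (Space N)] (hG : IsPotential G g) (x : Space N) : 0 < G x := by
  have hne : ∀ y : Space N, y ≠ 0 → 0 < G y := fun y hy => by
    rw [hG.radial]
    exact hG.profile_pos (norm_pos_iff.2 hy)
  by_cases hx : x = 0
  · subst hx
    obtain ⟨e, he⟩ := exists_ne (0 : Space N)
    refine (hne e he).trans_le ?_
    have ht : Tendsto (fun t : ℝ => G (t • e)) (𝓝[>] 0) (𝓝 (G 0)) := by
      have hcont : Continuous fun t : ℝ => G (t • e) := hG.continuous.comp (by fun_prop)
      simpa using (hcont.tendsto 0).mono_left (nhdsWithin_le_nhds (s := Ioi (0 : ℝ)))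
    refine ge_of_tendsto ht ?_
    filter_upwards [Ioo_mem_nhdsGT one_pos] with t ht
    have hn : 0 < ‖e‖ := norm_pos_iff.2 he
    rw [hG.radial, hG.radial, norm_smul, Real.norm_of_nonneg ht.1.le]
    exact hG.strictAntiOn.antitoneOn (mul_pos ht.1 hn) hn (by nlinarith [ht.2])
  · exact hne x hx

theorem tendsto_cocompact (hG : IsPotential G g) : Tendsto G (cocompact _) (𝓝 0) := by
  have : G = fun x => g ‖x‖ := funext hG.radial
  rw [this]
  exact hG.tendsto_zero.comp (tendsto_norm_cocompact_atTop)

theorem exists_abs_le (hG : IsPotential G g) : ∃ M, ∀ x, |G x| ≤ M := by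
  refine ⟨(eLpNorm G ⊤ volume).toReal, fun x => ?_⟩
  have hae : ∀ᵐ x, |G x| ≤ (eLpNorm G ⊤ volume).toReal := by
    filter_upwards [ae_le_eLpNormEssSup (f := G) (μ := volume)] with x hx
    rw [eLpNorm_exponent_top, ← Real.norm_eq_abs, ← toReal_enorm]
    refine ENNReal.toReal_mono ?_ hx
    have := hG.bounded.2
    rw [eLpNorm_exponent_top] at this
    exact this.ne
  have hcl : IsClosed {x | |G x| ≤ (eLpNorm G ⊤ volume).toReal} :=
    isClosed_le hG.continuous.abs continuous_const
  have hd : Dense {x | |G x| ≤ (eLpNorm G ⊤ volume).toReal} := Measure.dense_of_ae hae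
  have := hd.closure_eq ▸ mem_univ x
  rwa [hcl.closure_eq] at this

theorem integrable (hG : IsPotential G g) : Integrable G := hG.memW11.1

theorem integral_eq_one (hG : IsPotential G g) : ∫ x, G x = 1 := by
  rw [← hG.norm_one]
  congr 1 with x
  rw [abs_of_nonneg (hG.nonneg x)]

end IsPotential

/-! ### Essential support -/

theorem isClosed_essSupport (f : Space N → ℝ) : IsClosed (essSupport f) := by
  rw [← isOpen_compl_iff, isOpen_iff_mem_nhds]
  intro x hx
  simp only [essSupport, mem_compl_iff, mem_ofPred_eq, not_forall] at hx
  obtain ⟨U, hU, hU0⟩ := hx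
  filter_upwards [eventually_mem_nhds_iff.2 hU] with y hy hmem
  exact hU0 (hmem U hy)

theorem isCompact_essSupport_of_ae_eq_zero {f : Space N → ℝ} {K : Set (Space N)}
    (hK : IsCompact K) (h : ∀ᵐ x, x ∉ K → f x = 0) : IsCompact (essSupport f) := by
  refine hK.of_isClosed_subset (isClosed_essSupport f) fun x hx => ?_
  by_contra hxK
  have h0 := hx Kᶜ (hK.isClosed.isOpen_compl.mem_nhds hxK)
  refine h0.ne' (measure_mono_null (fun y hy => ?_) h)
  exact fun hy' => hy.1 (hy' hy.2)

/-! ### Euler–Lagrange conditions -/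

section EulerLagrange

variable {G : Space N → ℝ} {g : ℝ → ℝ} {m ε : ℝ} {ρ σ : Space N → ℝ}

/-- The first variation of the energy at `ρ`. -/
noncomputable def firstVariation (G : Space N → ℝ) (ε m : ℝ) (ρ : Space N → ℝ)
    (x : Space N) : ℝ :=
  ε * ρ x ^ (m - 1) - pot G ρ x

theorem integrable_firstVariation_mul (hG : IsPotential G g) (hm : 1 < m)
    (hρ : ρ ∈ admissible N m) (hσ : σ ∈ admissible N m) :
    Integrable fun x => firstVariation G ε m ρ x * σ x := by
  obtain ⟨M, hM⟩ := hG.exists_abs_le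
  refine (((integrable_rpow_sub_one_mul hm hρ hσ).const_mul ε).sub
    (integrable_pot_mul hG.continuous hM hρ.2.1 hσ.2.1)).congr (Eventually.of_forall fun x => ?_)
  simp only [firstVariation, Pi.sub_apply]
  ring

/-- The interaction is expanded exactly, evenness of `G` merging the two cross terms; the entropy is
bounded by convexity. The factor `t` is pulled out for division before `t → 0⁺`. -/
theorem energy_convexComb_sub_le (hG : IsPotential G g) (hm : 1 < m) (hε : 0 < ε)
    (hρ : ρ ∈ admissible N m) (hσ : σ ∈ admissible N m) {t : ℝ} (ht : t ∈ Icc (0 : ℝ) 1) :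
    energy G ε m (fun x => ρ x + t * (σ x - ρ x)) - energy G ε m ρ ≤
      t * (ε * (∫ x, (ρ x + t * (σ x - ρ x)) ^ (m - 1) * (σ x - ρ x))
        - (∫ x, pot G ρ x * (σ x - ρ x))
        - t / 2 * ∫ x, pot G (fun y => σ y - ρ y) x * (σ x - ρ x)) := by
  obtain ⟨M, hM⟩ := hG.exists_abs_le
  have hc := hG.continuous
  have hφ : Integrable fun x => σ x - ρ x := hσ.2.1.sub hρ.2.1
  have hτ := convexComb_mem_admissible hρ hσ ht
  have hquad : ∫ x, pot G (fun y => ρ y + t * (σ y - ρ y)) x * (ρ x + t * (σ x - ρ x)) =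
      (∫ x, pot G ρ x * ρ x) + 2 * t * (∫ x, pot G ρ x * (σ x - ρ x))
        + t ^ 2 * ∫ x, pot G (fun y => σ y - ρ y) x * (σ x - ρ x) := by
    have i1 := integrable_pot_mul hc hM hρ.2.1 hρ.2.1
    have i2 := integrable_pot_mul hc hM hρ.2.1 hφ
    have i3 := integrable_pot_mul hc hM hφ hρ.2.1
    have i4 := integrable_pot_mul hc hM hφ hφ
    have hsymm := integral_pot_mul_comm hc hM hG.even hφ hρ.2.1
    calc _ = ∫ x, (((pot G ρ x * ρ x + t * (pot G ρ x * (σ x - ρ x)))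
            + t * (pot G (fun y => σ y - ρ y) x * ρ x))
            + t ^ 2 * (pot G (fun y => σ y - ρ y) x * (σ x - ρ x))) := by
          congr 1 with x
          rw [pot_add_smul hc hM hρ.2.1 hφ]
          ring
      _ = _ := by
          have i12 : Integrable fun x => pot G ρ x * ρ x + t * (pot G ρ x * (σ x - ρ x)) :=
            i1.add (i2.const_mul t)
          have i123 : Integrable fun x => pot G ρ x * ρ x + t * (pot G ρ x * (σ x - ρ x))
              + t * (pot G (fun y => σ y - ρ y) x * ρ x) := i12.add (i3.const_mul t)
          rw [integral_add i123 (i4.const_mul _), integral_add i12 (i3.const_mul t),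
            integral_add i1 (i2.const_mul t)]
          simp only [integral_const_mul]
          rw [hsymm]
          ring
  have hent : (∫ x, (ρ x + t * (σ x - ρ x)) ^ m) - ∫ x, ρ x ^ m ≤
      m * (t * ∫ x, (ρ x + t * (σ x - ρ x)) ^ (m - 1) * (σ x - ρ x)) := by
    have iτ := integrable_rpow hm hτ
    have iρ := integrable_rpow hm hρ
    rw [← integral_sub iτ iρ, ← integral_const_mul, ← integral_const_mul]
    have i5 : Integrable fun x => (ρ x + t * (σ x - ρ x)) ^ (m - 1) * (σ x - ρ x) := by
      refine ((integrable_rpow_sub_one_mul hm hτ hσ).sub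
        (integrable_rpow_sub_one_mul hm hτ hρ)).congr (Eventually.of_forall fun x => ?_)
      simp only [Pi.sub_apply]
      ring
    refine integral_mono_ae (iτ.sub iρ) ((i5.const_mul t).const_mul m) ?_
    filter_upwards [hρ.2.2.1, hτ.2.2.1] with x h1 h2
    refine (rpow_sub_rpow_le h2 h1 hm).trans_eq ?_
    ring
  rw [energy_eq, energy_eq, hquad]
  have hm0 : 0 < m := by linarith
  have := mul_le_mul_of_nonneg_left hent (div_pos hε hm0).le
  have e : ε / m * (m * (t * ∫ x, (ρ x + t * (σ x - ρ x)) ^ (m - 1) * (σ x - ρ x))) =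
      t * (ε * ∫ x, (ρ x + t * (σ x - ρ x)) ^ (m - 1) * (σ x - ρ x)) := by
    field_simp
  rw [e] at this
  linarith

theorem integral_firstVariation_le (hG : IsPotential G g) (hm : 1 < m) (hε : 0 < ε)
    (hρ : IsGlobalMinimizer G ε m ρ) (hσ : σ ∈ admissible N m) :
    ∫ x, firstVariation G ε m ρ x * ρ x ≤ ∫ x, firstVariation G ε m ρ x * σ x := by
  obtain ⟨M, hM⟩ := hG.exists_abs_le
  set A := ∫ x, pot G ρ x * (σ x - ρ x) with hA
  set B := ∫ x, pot G (fun y => σ y - ρ y) x * (σ x - ρ x)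
  have hlim : Tendsto (fun t : ℝ =>
      ε * (∫ x, (ρ x + t * (σ x - ρ x)) ^ (m - 1) * (σ x - ρ x)) - A - t / 2 * B) (𝓝[>] 0)
      (𝓝 (ε * (∫ x, ρ x ^ (m - 1) * (σ x - ρ x)) - A - 0 / 2 * B)) := by
    refine (((tendsto_integral_rpow_convexComb hm hρ.1 hσ).const_mul ε).sub_const A).sub ?_
    exact ((tendsto_id.mono_left nhdsWithin_le_nhds).div_const 2).mul_const B
  have hnonneg : 0 ≤ ε * (∫ x, ρ x ^ (m - 1) * (σ x - ρ x)) - A - 0 / 2 * B := by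
    refine ge_of_tendsto hlim ?_
    filter_upwards [Ioo_mem_nhdsGT one_pos] with t ht
    have ht' : t ∈ Icc (0 : ℝ) 1 := Ioo_subset_Icc_self ht
    have h1 := energy_convexComb_sub_le hG hm hε hρ.1 hσ ht'
    have h2 := hρ.2 _ (convexComb_mem_admissible hρ.1 hσ ht')
    exact nonneg_of_mul_nonneg_right ((sub_nonneg.2 h2).trans h1) ht.1
  have hφ : Integrable fun x => σ x - ρ x := hσ.2.1.sub hρ.1.2.1
  have hd : Integrable fun x => ρ x ^ (m - 1) * (σ x - ρ x) := by
    refine ((integrable_rpow_sub_one_mul hm hρ.1 hσ).sub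
      (integrable_rpow_sub_one_mul hm hρ.1 hρ.1)).congr (Eventually.of_forall fun x => ?_)
    simp only [Pi.sub_apply]
    ring
  rw [← sub_nonneg, ← integral_sub (integrable_firstVariation_mul hG hm hρ.1 hσ)
    (integrable_firstVariation_mul hG hm hρ.1 hρ.1)]
  have : ∫ x, (firstVariation G ε m ρ x * σ x - firstVariation G ε m ρ x * ρ x) =
      ε * (∫ x, ρ x ^ (m - 1) * (σ x - ρ x)) - A := by
    rw [hA, ← integral_const_mul, ← integral_sub (hd.const_mul ε)
      (integrable_pot_mul hG.continuous hM hρ.1.2.1 hφ)]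
    congr 1 with x
    simp only [firstVariation]
    ring
  rw [this]
  linarith

/-- Taking normalized indicators as competitors shows that the average of the first variation over
every set of positive finite measure is at least `C`. -/
theorem ae_le_firstVariation (hG : IsPotential G g) (hm : 1 < m) (hε : 0 < ε)
    (hρ : IsGlobalMinimizer G ε m ρ) :
    ∀ᵐ x, ∫ y, firstVariation G ε m ρ y * ρ y ≤ firstVariation G ε m ρ x := by
  set C := ∫ y, firstVariation G ε m ρ y * ρ y
  have hind : ∀ s : Set (Space N), MeasurableSet s → volume s ≠ 0 → volume s ≠ ⊤ →
      IntegrableOn (firstVariation G ε m ρ) s ∧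
        C * volume.real s ≤ ∫ x in s, firstVariation G ε m ρ x := by
    intro s hs h0 htop
    have hpos : 0 < volume.real s := ENNReal.toReal_pos h0 htop
    have hadm := indicator_mem_admissible (N := N) m hs h0 htop
    have hle := integral_firstVariation_le hG hm hε hρ hadm
    have hi := integrable_firstVariation_mul (ε := ε) hG hm hρ.1 hadm
    have he : (fun x => firstVariation G ε m ρ x * s.indicator (fun _ => (volume.real s)⁻¹) x) =
        s.indicator fun x => firstVariation G ε m ρ x * (volume.real s)⁻¹ := by
      ext x
      by_cases hx : x ∈ s <;> simp [hx]
    rw [he] at hi hle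
    rw [integral_indicator hs, integral_mul_const, ← div_eq_mul_inv, le_div_iff₀ hpos] at hle
    rw [integrable_indicator_iff hs] at hi
    refine ⟨?_, hle⟩
    refine (hi.mul_const (volume.real s)).congr (Eventually.of_forall fun x => ?_)
    simp only
    rw [mul_assoc, inv_mul_cancel₀ hpos.ne', mul_one]
  have hint : ∀ s : Set (Space N), MeasurableSet s → volume s < ⊤ →
      IntegrableOn (firstVariation G ε m ρ) s := by
    intro s hs htop
    by_cases h0 : volume s = 0
    · exact IntegrableOn.of_measure_zero h0
    · exact (hind s hs h0 htop.ne).1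
  have key := ae_nonneg_of_forall_setIntegral_nonneg_of_sigmaFinite (μ := volume)
    (f := fun x => firstVariation G ε m ρ x - C)
    (fun s hs htop => (hint s hs htop).sub (integrableOn_const htop.ne)) (fun s hs htop => by
      rw [integral_sub (hint s hs htop) (integrableOn_const htop.ne), setIntegral_const,
        smul_eq_mul]
      by_cases h0 : volume s = 0
      · simp [Measure.restrict_eq_zero.2 h0, measureReal_def, h0]
      · have := (hind s hs h0 htop.ne).2
        linarith)
  filter_upwards [key] with x hx
  exact sub_nonneg.1 hx

/-- Since `ρ` has mass one, the a.e. nonnegative function `(firstVariation - C) ρ` has integral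
zero. -/
theorem ae_firstVariation_eq (hG : IsPotential G g) (hm : 1 < m) (hε : 0 < ε)
    (hρ : IsGlobalMinimizer G ε m ρ) :
    ∀ᵐ x, ρ x ≠ 0 → firstVariation G ε m ρ x = ∫ y, firstVariation G ε m ρ y * ρ y := by
  set C := ∫ y, firstVariation G ε m ρ y * ρ y with hC
  have h1 : Integrable fun x => firstVariation G ε m ρ x * ρ x :=
    integrable_firstVariation_mul hG hm hρ.1 hρ.1
  have h2 : Integrable fun x => C * ρ x := hρ.1.2.1.const_mul C
  have hnn : 0 ≤ᵐ[volume] fun x => firstVariation G ε m ρ x * ρ x - C * ρ x := by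
    filter_upwards [ae_le_firstVariation hG hm hε hρ, hρ.1.2.2.1] with x hx h0
    have := mul_le_mul_of_nonneg_right hx h0
    simpa using this
  have hz : ∫ x, (firstVariation G ε m ρ x * ρ x - C * ρ x) = 0 := by
    rw [integral_sub h1 h2, integral_const_mul, hρ.1.2.2.2, ← hC]
    ring
  filter_upwards [(integral_eq_zero_iff_of_nonneg_ae hnn (h1.sub h2)).1 hz] with x hx hne
  have : (firstVariation G ε m ρ x - C) * ρ x = 0 := by
    rw [sub_mul]
    exact hx
  exact sub_eq_zero.1 ((mul_eq_zero.1 this).resolve_right hne)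

end EulerLagrange

/-! ### Consequences of infinite volume -/

section InfiniteVolume

variable [Nontrivial (Space N)]

theorem volume_univ_space : volume (univ : Set (Space N)) = ⊤ :=
  measure_univ_of_isAddLeftInvariant _

theorem not_integrable_of_ae_le {f : Space N → ℝ} {c : ℝ} (hc : 0 < c)
    (h : ∀ᵐ x, c ≤ f x) : ¬ Integrable f := by
  intro hf
  have h1 : Integrable fun _ : Space N => c := by
    refine hf.mono' aestronglyMeasurable_const ?_
    filter_upwards [h] with x hx
    rwa [Real.norm_of_nonneg hc.le]
  rw [integrable_const_iff] at h1
  rcases h1 with h1 | h1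
  · exact hc.ne' h1
  · exact (measure_ne_top volume (univ : Set (Space N))) volume_univ_space

variable {G : Space N → ℝ} {g : ℝ → ℝ} {m ε : ℝ} {ρ : Space N → ℝ}

theorem pot_pos (hG : IsPotential G g) (hρ : ρ ∈ admissible N m) (x : Space N) :
    0 < pot G ρ x := by
  obtain ⟨M, hM⟩ := hG.exists_abs_le
  have hi := integrable_pot_kernel hG.continuous hM hρ.2.1 x
  have hnn : 0 ≤ᵐ[volume] fun y => G (x - y) * ρ y := by
    filter_upwards [hρ.2.2.1] with y hy
    exact mul_nonneg (hG.nonneg _) hy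
  refine (integral_nonneg_of_ae hnn).lt_of_ne' fun h0 => ?_
  have hz : ρ =ᵐ[volume] 0 := by
    filter_upwards [(integral_eq_zero_iff_of_nonneg_ae hnn hi).1 h0] with y hy
    exact (mul_eq_zero.1 hy).resolve_left (hG.pos _).ne'
  have := hρ.2.2.2
  rw [integral_congr_ae hz] at this
  simp at this

/-- Unit mass spread uniformly over volume `V` has entropy `ε / m * V ^ (-(m - 1))`, which tends to
`0`, and the interaction only lowers the energy. -/
theorem exists_energy_lt (hG : IsPotential G g) (hm : 1 < m) (ε : ℝ) {c : ℝ} (hc : 0 < c) :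
    ∃ σ ∈ admissible N m, energy G ε m σ < c := by
  have hlim : Tendsto (fun V : ℝ => ε / m * V ^ (-(m - 1))) atTop (𝓝 (ε / m * 0)) :=
    (tendsto_rpow_neg_atTop (by linarith)).const_mul _
  rw [mul_zero] at hlim
  obtain ⟨V₀, hV₀⟩ := eventually_atTop.1 (hlim.eventually (gt_mem_nhds hc))
  obtain ⟨s, hs, -, hlt, htop⟩ := Measure.exists_subset_measure_lt_top (μ := volume)
    (s := (univ : Set (Space N))) (r := ENNReal.ofReal (max V₀ 1)) MeasurableSet.univ
    (by rw [volume_univ_space]; exact ENNReal.ofReal_lt_top)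
  have h0 : volume s ≠ 0 := (zero_le.trans_lt hlt).ne'
  have hV : max V₀ 1 < volume.real s := (ENNReal.ofReal_lt_iff_lt_toReal (by positivity)
    htop.ne).1 hlt
  have hpos : 0 < volume.real s := ENNReal.toReal_pos h0 htop.ne
  refine ⟨_, indicator_mem_admissible m hs h0 htop.ne, ?_⟩
  refine lt_of_le_of_lt ?_ (hV₀ (volume.real s) ((le_max_left _ _).trans hV.le))
  have hpow : (fun x => s.indicator (fun _ => (volume.real s)⁻¹) x ^ m) =
      s.indicator fun _ => (volume.real s)⁻¹ ^ m := by
    ext x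
    by_cases hx : x ∈ s
    · simp [hx]
    · simp [hx, Real.zero_rpow (by linarith : m ≠ 0)]
  have hnn : ∀ x, 0 ≤ s.indicator (fun _ => (volume.real s)⁻¹) x :=
    fun x => indicator_nonneg (fun _ _ => by positivity) x
  have hint : 0 ≤ ∫ x, pot G (s.indicator fun _ => (volume.real s)⁻¹) x *
      s.indicator (fun _ => (volume.real s)⁻¹) x :=
    integral_nonneg fun x => mul_nonneg
      (integral_nonneg fun y => mul_nonneg (hG.nonneg _) (hnn y)) (hnn x)
  have hval : volume.real s * (volume.real s)⁻¹ ^ m = volume.real s ^ (-(m - 1)) := by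
    rw [Real.inv_rpow hpos.le, ← Real.rpow_neg hpos.le, mul_comm,
      ← Real.rpow_add_one hpos.ne']
    congr 1
    ring
  rw [energy_eq, hpow, integral_indicator_const _ hs, smul_eq_mul, hval]
  linarith

end InfiniteVolume

/-! ### Excluding a zero multiplier -/

section ZeroMultiplier

variable {G : Space N → ℝ} {g : ℝ → ℝ} {m ε : ℝ} {ρ : Space N → ℝ}

theorem energy_eq_of_eulerLagrange (hρ : ρ ∈ admissible N m)
    (hEL : ∀ᵐ x, ε * ρ x ^ (m - 1) = pot G ρ x) (hm : 1 < m) :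
    energy G ε m ρ = (1 / m - 1 / 2) * (ε * ∫ x, ρ x ^ m) := by
  have : ∫ x, pot G ρ x * ρ x = ε * ∫ x, ρ x ^ m := by
    rw [← integral_const_mul]
    refine integral_congr_ae ?_
    filter_upwards [hEL, hρ.2.2.1] with x hx h0
    rw [← hx, mul_assoc, rpow_sub_one_mul_self h0 hm]
  rw [energy_eq, this]
  ring

variable [Nontrivial (Space N)]

theorem ae_pos_of_eulerLagrange (hG : IsPotential G g) (hm : 1 < m) (hρ : ρ ∈ admissible N m)
    (hEL : ∀ᵐ x, ε * ρ x ^ (m - 1) = pot G ρ x) : ∀ᵐ x, 0 < ρ x := by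
  filter_upwards [hEL, hρ.2.2.1] with x hx h0
  refine h0.lt_of_ne' fun hz => ?_
  rw [hz, Real.zero_rpow (by linarith), mul_zero] at hx
  exact (pot_pos hG hρ x).ne hx

theorem not_eulerLagrange_of_lt_two (hG : IsPotential G g) (hm : 1 < m) (hm2 : m < 2)
    (hε : 0 < ε) (hρ : IsGlobalMinimizer G ε m ρ) :
    ¬ ∀ᵐ x, ε * ρ x ^ (m - 1) = pot G ρ x := by
  intro hEL
  have hpos : 0 < ∫ x, ρ x ^ m := by
    have hnn : 0 ≤ᵐ[volume] fun x => ρ x ^ m := by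
      filter_upwards [hρ.1.2.2.1] with x hx using Real.rpow_nonneg hx m
    refine (integral_nonneg_of_ae hnn).lt_of_ne' fun h0 => ?_
    have hz := (integral_eq_zero_iff_of_nonneg_ae hnn (integrable_rpow hm hρ.1)).1 h0
    have hfalse : ∀ᵐ _ : Space N, False := by
      filter_upwards [hz, ae_pos_of_eulerLagrange hG hm hρ.1 hEL] with x hx h1
      exact (Real.rpow_pos_of_pos h1 m).ne' hx
    rw [eventually_false_iff_eq_bot, ae_eq_bot] at hfalse
    have h2 := volume_univ_space (N := N)
    rw [hfalse] at h2
    simp at h2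
  have hE : 0 < energy G ε m ρ := by
    rw [energy_eq_of_eulerLagrange hρ.1 hEL hm]
    refine mul_pos (sub_pos.2 ?_) (mul_pos hε hpos)
    exact one_div_lt_one_div_of_lt (by linarith) hm2
  obtain ⟨σ, hσ, hlt⟩ := exists_energy_lt hG hm ε hE
  exact (hρ.2 σ hσ).not_gt hlt

/-- Integrating the equation with `∫ G = 1` forces `ε = 1`. At a maximum point, `u = G * u` is an
average with strictly positive weights, so `u` is a.e. at least its maximum, a positive constant. -/
theorem not_eulerLagrange_two (hG : IsPotential G g) (hε : 0 < ε) (hρ : ρ ∈ admissible N 2) :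
    ¬ ∀ᵐ x, ε * ρ x ^ ((2 : ℝ) - 1) = pot G ρ x := by
  intro hEL
  obtain ⟨M, hM⟩ := hG.exists_abs_le
  have hc := hG.continuous
  set u := pot G ρ
  have hu : ∀ᵐ x, ε * ρ x = u x := by
    filter_upwards [hEL] with x hx
    rw [← hx]
    norm_num
  have hε1 : ε = 1 := by
    have h1 : ∫ x, u x = 1 := by
      rw [integral_pot hG.integrable hρ.2.1, hG.integral_eq_one, hρ.2.2.2, one_mul]
    rw [← integral_congr_ae hu, integral_const_mul, hρ.2.2.2, mul_one] at h1
    exact h1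
  subst hε1
  have hu' : ρ =ᵐ[volume] u := by
    filter_upwards [hu] with x hx
    rw [← hx, one_mul]
  have hint : Integrable u := hρ.2.1.congr hu'
  have hcont : Continuous u := continuous_pot hc hM hρ.2.1
  have hupos : ∀ x, 0 < u x := pot_pos hG hρ
  have hfix : ∀ x, ∫ y, G (x - y) * u y = u x := fun x => by
    refine integral_congr_ae ?_
    filter_upwards [hu'] with y hy
    rw [hy]
  -- The maximum is attained because `u` is positive at `0` and vanishes at infinity.
  obtain ⟨x₀, hx₀⟩ := hcont.exists_forall_ge' (0 : Space N)
    ((tendsto_pot hc hM hG.tendsto_cocompact hρ.2.1).eventually (ge_mem_nhds (hupos 0)))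
  have hGi : Integrable fun y => G (x₀ - y) := hG.integrable.comp_sub_left x₀
  have hi1 : Integrable fun y => G (x₀ - y) * u x₀ := hGi.mul_const _
  have hi2 : Integrable fun y => G (x₀ - y) * u y := integrable_pot_kernel hc hM hint x₀
  have hz : ∫ y, (G (x₀ - y) * u x₀ - G (x₀ - y) * u y) = 0 := by
    rw [integral_sub hi1 hi2, hfix, integral_mul_const, integral_sub_left_eq_self,
      hG.integral_eq_one]
    ring
  have hnn : 0 ≤ᵐ[volume] fun y => G (x₀ - y) * u x₀ - G (x₀ - y) * u y :=
    Eventually.of_forall fun y => sub_nonneg.2 (mul_le_mul_of_nonneg_left (hx₀ y) (hG.nonneg _))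
  refine not_integrable_of_ae_le (hupos x₀) ?_ hint
  filter_upwards [(integral_eq_zero_iff_of_nonneg_ae hnn (hi1.sub hi2)).1 hz] with y hy
  exact le_of_mul_le_mul_left (sub_nonpos.1 hy.le) (hG.pos (x₀ - y))

/-- On a distant unit ball of volume `V` carrying mass `I`, the potential is at least `δ I`, while
smallness of `ρ` gives `ε ρ^(m-1) ≤ (δ V / 2) ρ`. Integration yields `V δ I ≤ V δ I / 2`, although
`I > 0`. -/
theorem not_eulerLagrange_of_two_lt (hG : IsPotential G g) (hm : 2 < m) (hε : 0 < ε)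
    (hρ : ρ ∈ admissible N m) : ¬ ∀ᵐ x, ε * ρ x ^ (m - 1) = pot G ρ x := by
  intro hEL
  obtain ⟨M, hM⟩ := hG.exists_abs_le
  -- Two points of a unit ball are at distance at most `2`.
  obtain ⟨z, -, hz⟩ := (isCompact_closedBall (0 : Space N) 2).exists_isMinOn
    ⟨0, by simp⟩ hG.continuous.continuousOn
  set δ := G z with hδdef
  have hδ : 0 < δ := hG.pos z
  set V := volume.real (Metric.ball (0 : Space N) 1) with hV
  have hVpos : 0 < V := ENNReal.toReal_pos (Metric.measure_ball_pos _ _ one_pos).ne'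
    measure_ball_lt_top.ne
  -- Chosen so that `ε s^(m-2) = δ V / 2`; the exponent `m - 2` is positive, so this also bounds `ε
  -- ρ^(m-2)` wherever `ρ ≤ s`.
  set s := (δ * V / (2 * ε)) ^ (m - 2)⁻¹
  have hs0 : 0 < δ * V / (2 * ε) := by positivity
  have hs : 0 < s := Real.rpow_pos_of_pos hs0 _
  have hsm : ε * s ^ (m - 2) = δ * V / 2 := by
    rw [Real.rpow_inv_rpow hs0.le (by linarith)]
    field_simp
  have hfar : ∀ᶠ x in cocompact (Space N), pot G ρ x < ε * s ^ (m - 1) :=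
    (tendsto_pot hG.continuous hM hG.tendsto_cocompact hρ.2.1).eventually
      (gt_mem_nhds (by positivity))
  rw [← Metric.cobounded_eq_cocompact, ← comap_norm_atTop, eventually_comap] at hfar
  obtain ⟨R, hR⟩ := eventually_atTop.1 hfar
  -- The extra `1` keeps the whole unit ball about `x` outside radius `R`.
  obtain ⟨x, hx⟩ := NormedSpace.exists_lt_norm ℝ (Space N) (R + 1)
  set B := Metric.ball x 1 with hB
  set I := ∫ y in B, ρ y with hI
  have hVB : volume.real B = V := by
    rw [hV, hB, measureReal_def, measureReal_def, Measure.addHaar_ball_center]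
  have hpot : ∀ y ∈ B, δ * I ≤ pot G ρ y := by
    intro y hy
    have hi := integrable_pot_kernel hG.continuous hM hρ.2.1 y
    calc δ * I = ∫ w in B, δ * ρ w := by rw [integral_const_mul]
      _ ≤ ∫ w in B, G (y - w) * ρ w := by
          refine setIntegral_mono_on_ae (hρ.2.1.integrableOn.const_mul δ) hi.integrableOn
            measurableSet_ball ?_
          filter_upwards [hρ.2.2.1] with w hw hwB
          refine mul_le_mul_of_nonneg_right (hz ?_) hw
          rw [mem_closedBall_zero_iff, ← dist_eq_norm]
          have h1 := Metric.mem_ball.1 hy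
          have h2 := Metric.mem_ball'.1 hwB
          linarith [dist_triangle y x w]
      _ ≤ pot G ρ y := by
          refine setIntegral_le_integral hi ?_
          filter_upwards [hρ.2.2.1] with w hw using mul_nonneg (hG.nonneg _) hw
  have hsmall : ∀ᵐ y, y ∈ B → δ * I ≤ δ * V / 2 * ρ y := by
    filter_upwards [hEL, hρ.2.2.1] with y hy h0 hyB
    have hyR : R ≤ ‖y‖ := by
      have h1 := Metric.mem_ball'.1 hyB
      rw [dist_eq_norm] at h1
      linarith [norm_sub_norm_le x y]
    have hlt := hR ‖y‖ hyR y rfl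
    rw [← hy] at hlt
    have hρs : ρ y ≤ s :=
      (Real.rpow_le_rpow_iff h0 hs.le (by linarith)).1 (lt_of_mul_lt_mul_left hlt hε.le).le
    calc δ * I ≤ pot G ρ y := hpot y hyB
      _ = ε * (ρ y ^ (m - 1 - 1) * ρ y) := by rw [← hy, rpow_sub_one_mul_self h0 (by linarith)]
      _ ≤ ε * (s ^ (m - 1 - 1) * ρ y) := by
          gcongr
          linarith
      _ = δ * V / 2 * ρ y := by
          rw [← hsm, show m - 1 - 1 = m - 2 by ring]
          ring
  have hle : V * (δ * I) ≤ δ * V / 2 * I := by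
    calc V * (δ * I) = ∫ _ in B, δ * I := by rw [setIntegral_const, hVB, smul_eq_mul]
      _ ≤ ∫ y in B, δ * V / 2 * ρ y :=
          setIntegral_mono_on_ae (integrableOn_const measure_ball_lt_top.ne)
            (hρ.2.1.integrableOn.const_mul _) measurableSet_ball hsmall
      _ = δ * V / 2 * I := integral_const_mul _ _
  have hIpos : 0 < I := by
    refine (setIntegral_nonneg_of_ae hρ.2.2.1).lt_of_ne' fun h0 => ?_
    have h1 := (setIntegral_eq_zero_iff_of_nonneg_ae (ae_restrict_of_ae hρ.2.2.1)
      hρ.2.1.integrableOn).1 h0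
    have hfalse : ∀ᵐ _ ∂(volume.restrict B), False := by
      filter_upwards [h1, ae_restrict_of_ae
        (ae_pos_of_eulerLagrange hG (by linarith) hρ hEL)] with y h2 h3
      exact h3.ne' h2
    rw [eventually_false_iff_eq_bot, ae_eq_bot, Measure.restrict_eq_zero] at hfalse
    exact (Metric.measure_ball_pos volume x one_pos).ne' hfalse
  nlinarith [mul_pos (mul_pos hδ hVpos) hIpos]

end ZeroMultiplier

/-! ### Conclusion by the sign of the multiplier -/

theorem isCompact_essSupport_of_isGlobalMinimizer [Nontrivial (Space N)] {G : Space N → ℝ}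
    {g : ℝ → ℝ} {m ε : ℝ} {ρ : Space N → ℝ} (hG : IsPotential G g) (hm : 1 < m) (hε : 0 < ε)
    (hρ : IsGlobalMinimizer G ε m ρ) : IsCompact (essSupport ρ) := by
  obtain ⟨M, hM⟩ := hG.exists_abs_le
  have hge := ae_le_firstVariation hG hm hε hρ
  have heq := ae_firstVariation_eq hG hm hε hρ
  set C := ∫ y, firstVariation G ε m ρ y * ρ y
  have hm1 : 0 < m - 1 := by linarith
  rcases lt_trichotomy C 0 with hC | hC | hC
  · have hfar : ∀ᶠ x in cocompact (Space N), pot G ρ x < -C :=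
      (tendsto_pot hG.continuous hM hG.tendsto_cocompact hρ.1.2.1).eventually
        (gt_mem_nhds (neg_pos.2 hC))
    obtain ⟨K, hK, hKsub⟩ := mem_cocompact.1 hfar
    refine isCompact_essSupport_of_ae_eq_zero hK ?_
    filter_upwards [heq, hρ.1.2.2.1] with x hx h0 hxK
    by_contra hne
    have h1 : pot G ρ x < -C := hKsub hxK
    have h2 : ε * ρ x ^ (m - 1) - pot G ρ x = C := hx hne
    have h3 : 0 ≤ ε * ρ x ^ (m - 1) := mul_nonneg hε.le (Real.rpow_nonneg h0 _)
    linarith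
  · have hEL : ∀ᵐ x, ε * ρ x ^ (m - 1) = pot G ρ x := by
      filter_upwards [hge, heq] with x h1 h2
      by_cases h0 : ρ x = 0
      · have h3 : C ≤ ε * ρ x ^ (m - 1) - pot G ρ x := h1
        rw [h0, Real.zero_rpow hm1.ne', mul_zero] at h3
        linarith [pot_pos hG hρ.1 x]
      · have h3 : ε * ρ x ^ (m - 1) - pot G ρ x = C := h2 h0
        linarith
    rcases lt_trichotomy m 2 with h2 | rfl | h2
    · exact absurd hEL (not_eulerLagrange_of_lt_two hG hm h2 hε hρ)
    · exact absurd hEL (not_eulerLagrange_two hG hε hρ.1)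
    · exact absurd hEL (not_eulerLagrange_of_two_lt hG h2 hε hρ.1)
  · refine absurd hρ.1.2.1 (not_integrable_of_ae_le
      (Real.rpow_pos_of_pos (div_pos hC hε) (m - 1)⁻¹) ?_)
    filter_upwards [hge, hρ.1.2.2.1] with x hx h0
    have h1 : C ≤ ε * ρ x ^ (m - 1) - pot G ρ x := hx
    rw [Real.rpow_inv_le_iff_of_pos (div_pos hC hε).le h0 hm1, div_le_iff₀ hε]
    linarith [pot_pos hG hρ.1 x]

end Aggregation

theorem mainTheorem3 (N : ℕ) (G : Aggregation.Space N → ℝ) (g : ℝ → ℝ)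
    (hG : Aggregation.IsPotential G g) (m ε : ℝ) (hm : 1 < m) (hε : 0 < ε)
    (ρ : Aggregation.Space N → ℝ) (hρ : Aggregation.IsGlobalMinimizer G ε m ρ) :
    IsCompact (Aggregation.essSupport ρ) := by
  -- The formal statement allows `N = 0`, where the space is a single point.
  rcases subsingleton_or_nontrivial (Aggregation.Space N) with h | h
  · exact (toFinite (Aggregation.essSupport ρ)).isCompact
  · exact Aggregation.isCompact_essSupport_of_isGlobalMinimizer hG hm hε hρ
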